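/- Let $d\ge 1$ and $r\ge 1$ be integers. For $n\in\mathbb Z$ and $w\in\mathbb C$ let $I_n(w)=\frac1\pi\int_0^\pi e^{w\cos\theta}\cos(n\theta)\,d\theta$ be the modified Bessel function of the first kind. Put $D=\{z\in\mathbb C: |\operatorname{Re} z|<\frac1{2d}\}$ and, for $x=(x_1,\dots,x_d)\in\mathbb Z^d$ and $z\in D$, $$h(x,d,z)=-\delta_{x,0}+\int_0^\infty e^{-y}\prod_{i=1}^d I_{x_i}(2yz)\,dy .$$ Let $P_0=\{z\in D: 1+h(0,d,z)=0\}$, and let $J_r$ be the set of all $Y=(Y_1,\dots,Y_r)\in(\mathbb Z^d)^r$ with $Y_1=0$ and $Y_i\ne Y_j$ for $i\neq j$. For $Y\in J_r$ and $z\in D\setminus P_0$ define the first hit determinant $$\Delta_r(Y,z)=\det\bigl(1_{r\times r}+U(Y,z)\bigr),\qquad U_{i,j}(Y,z)=\frac{h(Y_i-Y_j,d,z)}{1+h(0,d,z)}\ (i\ne j),\qquad U_{i,i}(Y,z)=0 .$$ For real $R,a$ let $M_{R,a}=\{z\in\mathbb C: |z|\le R,\ |\operatorname{Re} z|\le a\}$.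 (1) For all real $\delta>0$ and $\gamma_r<1$ there is an $\epsilon>0$ (depending only on $d,r,\delta,\gamma_r$) such that $M_{\frac1{2d}+\epsilon,\frac1{2d}-\delta}\subseteq D\setminus P_0$, and for all $z\in M_{\frac1{2d}+\epsilon,\frac1{2d}-\delta}$ and all $Y\in J_r$ $$|\Delta_r(Y,z)|\ \ge\ \frac{\gamma_r}{\bigl(2(1+|h(0,d,z)|)\bigr)^{r-1}} .$$ (2) There is an open set $U\subseteq D\setminus P_0$, not depending on $Y$, which contains $\{z\in D: |z|\le\frac1{2d}\}$ and is such that $\Delta_r(Y,z)\ne0$ for all $z\in U$ and all $Y\in J_r$. -/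

import Mathlib

noncomputable section

namespace FirstHit

/-- The modified Bessel function of the first kind `I_n` of integer order `n`:
`I_n(w) = (1/π) ∫_0^π exp(w cos θ) cos(n θ) dθ`. -/
def besselI (n : ℤ) (w : ℂ) : ℂ :=
  (1 / (Real.pi : ℂ)) *
    ∫ θ in (0 : ℝ)..Real.pi, Complex.exp (w * (Real.cos θ : ℂ)) * (Real.cos (n * θ) : ℂ)

/-- The open strip `D = {z ∈ ℂ : |Re z| < 1/(2d)}`. -/
def strip (d : ℕ) : Set ℂ := {z | |z.re| < 1 / (2 * (d : ℝ))}

/-- `h(x,d,z) = -δ_{x,0} + ∫_0^∞ e^{-y} ∏_{i=1}^d I_{x_i}(2 y z) dy`; the integral converges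
absolutely for `z` in the strip `D`, and `h` is only used there. -/
def h (d : ℕ) (x : Fin d → ℤ) (z : ℂ) : ℂ :=
  -(if x = 0 then 1 else 0) +
    ∫ y in Set.Ioi (0 : ℝ),
      Complex.exp (-(y : ℂ)) * ∏ i : Fin d, besselI (x i) (2 * (y : ℂ) * z)

/-- `P₀ = {z ∈ D : 1 + h(0,d,z) = 0}`. -/
def poleSet (d : ℕ) : Set ℂ := {z | z ∈ strip d ∧ 1 + h d 0 z = 0}

/-- `J_r`: the `r`-tuples of pairwise distinct points of `ℤ^d` whose first entry is `0`. -/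
def J (d r : ℕ) : Set (Fin r → Fin d → ℤ) :=
  {Y | (∀ hr : 0 < r, Y ⟨0, hr⟩ = 0) ∧ ∀ i j : Fin r, i ≠ j → Y i ≠ Y j}

/-- The matrix of first hit functions: zero on the diagonal, and
`U_{i,j}(Y,z) = h(Y_i - Y_j,d,z) / (1 + h(0,d,z))` for `i ≠ j`. -/
def hitMatrix {d r : ℕ} (Y : Fin r → Fin d → ℤ) (z : ℂ) : Matrix (Fin r) (Fin r) ℂ :=
  Matrix.of fun i j => if i = j then 0 else h d (Y i - Y j) z / (1 + h d 0 z)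

/-- The first hit determinant `Δ_r(Y,z) = det (1 + U(Y,z))`, for `z ∈ D \ P₀`. -/
def hitDet {d r : ℕ} (Y : Fin r → Fin d → ℤ) (z : ℂ) : ℂ :=
  (1 + hitMatrix Y z).det

/-- `M_{R,a} = {z ∈ ℂ : |z| ≤ R, |Re z| ≤ a}`. -/
def slab (R a : ℝ) : Set ℂ := {z | ‖z‖ ≤ R ∧ |z.re| ≤ a}

end FirstHit

end

noncomputable section

namespace FirstHit

open MeasureTheory Complex ComplexConjugate

/-! Put `G(x,z) = δ_{x,0} + h(x,d,z)`. Fubini turns it into a Fourier coefficient of `f = 1/(1 -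
w)`, `w = 2z ∑ cos θ_i` (`delta_add_h_eq_green`), and `1 + U` is the matrix `G(Y_i - Y_j)` divided
by `G(0)`. The quadratic form of that matrix is the integral of `f` against `|∑ conj(v_i) e^{i
Y_i·θ}|²`. The `Y_i` are distinct, so by Parseval `Re f ≥ m` puts its numerical range in `Re ≥ m`
(`le_re_quadraticForm_green`), and `pow_mul_norm_le_norm_det` bounds the determinant below,
uniformly in `Y`. It remains to choose `m`. For `|w| ≤ 1`, `w ≠ 1`, one has `Re 1/(1 - w) ≥ 1/2`;
this nearly persists for `|w|` slightly above 1 away from `Re w = 1`, which gives (1). On the whole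
strip `Re w < 1`, so some `m > 0` exists for each `z`, which gives (2). -/

/-- A complex matrix whose numerical range has real part at least `m` has determinant at least
`m ^ n * ‖A 0 0‖` in absolute value. -/
theorem pow_mul_norm_le_norm_det {m : ℝ} (hm : 0 ≤ m) (n : ℕ)
    (A : Matrix (Fin (n + 1)) (Fin (n + 1)) ℂ)
    (hA : ∀ v : Fin (n + 1) → ℂ, m * ∑ i, ‖v i‖ ^ 2 ≤ (star v ⬝ᵥ A.mulVec v).re) :
    m ^ n * ‖A 0 0‖ ≤ ‖A.det‖ := by
  induction n with
  | zero => simp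
  | succ n ih =>
    set B : Matrix (Fin (n + 1)) (Fin (n + 1)) ℂ := A.submatrix Fin.castSucc Fin.castSucc with hB
    have hBdet : m ^ n * ‖A 0 0‖ ≤ ‖B.det‖ := by
      refine ih B fun v => ?_
      have := hA (Fin.snoc v 0)
      simpa [dotProduct, Matrix.mulVec, Fin.sum_univ_castSucc, hB] using this
    -- Test vector: `A v = det A • e_last` and the last entry of `v` is the minor `det B`, so the
    -- form at `v` is `conj (det B) * det A`.
    set v : Fin (n + 2) → ℂ := A.adjugate.mulVec (Pi.single (Fin.last _) 1) with hv
    have hvlast : v (Fin.last _) = B.det := by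
      rw [hv, Matrix.mulVec_single_one, Matrix.col_apply,
        Matrix.adjugate_fin_succ_eq_det_submatrix]
      have hs : (-1 : ℂ) ^ ((Fin.last (n + 1) : ℕ) + (Fin.last (n + 1) : ℕ)) = 1 :=
        Even.neg_one_pow ⟨_, rfl⟩
      rw [hs, one_mul, hB, Fin.succAbove_last]
    have hAv : A.mulVec v = A.det • Pi.single (Fin.last _) 1 := by
      rw [hv, Matrix.mulVec_mulVec, Matrix.mul_adjugate, Matrix.smul_mulVec, Matrix.one_mulVec]
    have hval : star v ⬝ᵥ A.mulVec v = star B.det * A.det := by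
      rw [hAv, dotProduct_smul, dotProduct_single, Pi.star_apply, hvlast, smul_eq_mul]
      ring
    have h1 : m * ‖B.det‖ ^ 2 ≤ ‖B.det‖ * ‖A.det‖ := by
      calc m * ‖B.det‖ ^ 2 ≤ m * ∑ i, ‖v i‖ ^ 2 := by
            rw [← hvlast]
            exact mul_le_mul_of_nonneg_left
              (Finset.single_le_sum (f := fun i => ‖v i‖ ^ 2) (fun i _ => by positivity)
                (Finset.mem_univ _)) hm
        _ ≤ (star v ⬝ᵥ A.mulVec v).re := hA v
        _ ≤ ‖star v ⬝ᵥ A.mulVec v‖ := re_le_norm _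
        _ = ‖B.det‖ * ‖A.det‖ := by rw [hval, norm_mul, norm_star]
    have h2 : m * ‖B.det‖ ≤ ‖A.det‖ := by
      rcases (norm_nonneg B.det).eq_or_lt with h0 | h0
      · rw [← h0, mul_zero]; exact norm_nonneg _
      · refine le_of_mul_le_mul_left ?_ h0
        linarith
    calc m ^ (n + 1) * ‖A 0 0‖ = m * (m ^ n * ‖A 0 0‖) := by ring
      _ ≤ m * ‖B.det‖ := mul_le_mul_of_nonneg_left hBdet hm
      _ ≤ ‖A.det‖ := h2

/-! ### Fourier representation of Bessel products -/

/-- The uniform probability measure on `(-π, π]`. -/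
def angleMeasure : Measure ℝ :=
  ENNReal.ofReal (1 / (2 * Real.pi)) • volume.restrict (Set.Ioc (-Real.pi) Real.pi)

instance : IsProbabilityMeasure angleMeasure := by
  constructor
  rw [angleMeasure, Measure.smul_apply, Measure.restrict_apply_univ, Real.volume_Ioc, smul_eq_mul,
    ← ENNReal.ofReal_mul (by positivity)]
  have : 1 / (2 * Real.pi) * (Real.pi - -Real.pi) = 1 := by
    field_simp
    ring
  rw [this, ENNReal.ofReal_one]

theorem integral_angleMeasure (f : ℝ → ℂ) :
    ∫ θ, f θ ∂angleMeasure
      = (1 / (2 * Real.pi) : ℂ) * ∫ θ in (-Real.pi)..Real.pi, f θ := by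
  rw [angleMeasure, integral_smul_measure, intervalIntegral.integral_of_le
    (by linarith [Real.pi_pos]), ENNReal.toReal_ofReal (by positivity), real_smul]
  push_cast
  rfl

theorem besselI_eq_integral (n : ℤ) (w : ℂ) :
    besselI n w = ∫ θ, exp (w * (Real.cos θ : ℂ)) * exp (I * (n * θ)) ∂angleMeasure := by
  have hcont : Continuous fun θ : ℝ => exp (w * (Real.cos θ : ℂ)) * exp (I * (n * θ)) := by
    fun_prop
  have hcont' : Continuous fun θ : ℝ => exp (w * (Real.cos θ : ℂ)) * exp (-(I * (n * θ))) := by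
    fun_prop
  have hneg : ∫ θ in (-Real.pi)..0, exp (w * (Real.cos θ : ℂ)) * exp (I * (n * θ))
      = ∫ θ in (0 : ℝ)..Real.pi, exp (w * (Real.cos θ : ℂ)) * exp (-(I * (n * θ))) := by
    have := intervalIntegral.integral_comp_neg (a := 0) (b := Real.pi)
      fun θ : ℝ => exp (w * (Real.cos θ : ℂ)) * exp (I * (n * θ))
    rw [neg_zero] at this
    rw [← this]
    refine intervalIntegral.integral_congr fun θ _ => ?_
    simp
  rw [integral_angleMeasure, ← intervalIntegral.integral_add_adjacent_intervals
    (hcont.intervalIntegrable (-Real.pi) 0) (hcont.intervalIntegrable 0 Real.pi), hneg,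
    ← intervalIntegral.integral_add (hcont'.intervalIntegrable _ _)
    (hcont.intervalIntegrable _ _), besselI]
  have : ∀ θ : ℝ, exp (w * (Real.cos θ : ℂ)) * exp (-(I * (n * θ)))
      + exp (w * (Real.cos θ : ℂ)) * exp (I * (n * θ))
      = 2 * (exp (w * (Real.cos θ : ℂ)) * (Real.cos (n * θ) : ℂ)) := by
    intro θ
    rw [ofReal_cos (n * θ), Complex.cos]
    push_cast
    rw [neg_mul, mul_comm (n * θ : ℂ) I]
    ring
  simp_rw [this]
  rw [intervalIntegral.integral_const_mul]
  ring

/-- The uniform probability measure on the torus `(-π, π]^d`. -/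
def torusMeasure (d : ℕ) : Measure (Fin d → ℝ) := Measure.pi fun _ => angleMeasure

instance (d : ℕ) : IsProbabilityMeasure (torusMeasure d) := by
  unfold torusMeasure
  infer_instance

/-- The character `θ ↦ exp (i x·θ)`. -/
def character {d : ℕ} (x : Fin d → ℤ) (θ : Fin d → ℝ) : ℂ := ∏ i, exp (I * (x i * θ i))

theorem continuous_character {d : ℕ} (x : Fin d → ℤ) : Continuous (character x) := by
  unfold character
  fun_prop

theorem norm_character {d : ℕ} (x : Fin d → ℤ) (θ : Fin d → ℝ) : ‖character x θ‖ = 1 := by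
  rw [character, norm_prod]
  refine Finset.prod_eq_one fun i _ => ?_
  have := norm_exp_I_mul_ofReal ((x i : ℝ) * θ i)
  push_cast at this
  exact this

theorem character_sub {d : ℕ} (x y : Fin d → ℤ) (θ : Fin d → ℝ) :
    character (x - y) θ = character x θ * conj (character y θ) := by
  simp only [character, map_prod, ← Finset.prod_mul_distrib]
  refine Finset.prod_congr rfl fun i _ => ?_
  rw [← exp_conj, ← Complex.exp_add]
  congr 1
  simp
  ring

/-- The sum of the cosines of the coordinates. -/
def cosSum {d : ℕ} (θ : Fin d → ℝ) : ℝ := ∑ i, Real.cos (θ i)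

theorem continuous_cosSum {d : ℕ} : Continuous (cosSum (d := d)) := by
  unfold cosSum
  fun_prop

theorem abs_cosSum_le {d : ℕ} (θ : Fin d → ℝ) : |cosSum θ| ≤ d := by
  calc |cosSum θ| ≤ ∑ i, |Real.cos (θ i)| := Finset.abs_sum_le_sum_abs _ _
    _ ≤ ∑ _i : Fin d, (1 : ℝ) := Finset.sum_le_sum fun i _ => Real.abs_cos_le_one _
    _ = d := by simp

theorem prod_besselI_eq_integral {d : ℕ} (x : Fin d → ℤ) (w : ℂ) :
    ∏ i, besselI (x i) w = ∫ θ, exp (w * cosSum θ) * character x θ ∂torusMeasure d := by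
  simp_rw [besselI_eq_integral]
  rw [torusMeasure, ← integral_fintype_prod_eq_prod]
  refine integral_congr_ae (Filter.Eventually.of_forall fun θ => ?_)
  simp only [Finset.prod_mul_distrib, character, cosSum, ofReal_sum, Finset.mul_sum,
    Complex.exp_sum]

theorem strip_bound {d : ℕ} (hd : 1 ≤ d) {z : ℂ} (hz : z ∈ strip d) : 2 * d * |z.re| < 1 := by
  have hd' : (0 : ℝ) < d := by exact_mod_cast hd
  have : |z.re| < 1 / (2 * (d : ℝ)) := hz
  rw [lt_div_iff₀ (by positivity)] at this
  linarith

theorem re_two_mul_mul_ofReal (z : ℂ) (s : ℝ) : (2 * z * s).re = 2 * (z.re * s) := by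
  simp [mul_assoc]

theorem re_mul_cosSum_le {d : ℕ} (z : ℂ) (θ : Fin d → ℝ) :
    (2 * z * cosSum θ).re ≤ 2 * d * |z.re| := by
  have : z.re * cosSum θ ≤ |z.re| * d := by
    calc z.re * cosSum θ ≤ |z.re * cosSum θ| := le_abs_self _
      _ = |z.re| * |cosSum θ| := abs_mul _ _
      _ ≤ |z.re| * d := mul_le_mul_of_nonneg_left (abs_cosSum_le θ) (abs_nonneg _)
  rw [re_two_mul_mul_ofReal]
  linarith

theorem norm_mul_cosSum_le {d : ℕ} (z : ℂ) (θ : Fin d → ℝ) :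
    ‖2 * z * cosSum θ‖ ≤ 2 * d * ‖z‖ := by
  rw [norm_mul, norm_mul, norm_real, Real.norm_eq_abs, Complex.norm_ofNat]
  nlinarith [mul_le_mul_of_nonneg_left (abs_cosSum_le θ) (norm_nonneg z)]

/-! ### The lattice Green function and its quadratic form -/

/-- The lattice Green function as a Fourier integral. -/
def green {d : ℕ} (x : Fin d → ℤ) (z : ℂ) : ℂ :=
  ∫ θ, character x θ * (1 - 2 * z * cosSum θ)⁻¹ ∂torusMeasure d

/-- Fubini applies because `Re (1 - 2 z cosSum θ) ≥ 1 - 2d|Re z| > 0` makes `exp (-a y)` an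
integrable majorant. -/
theorem delta_add_h_eq_green {d : ℕ} (hd : 1 ≤ d) (x : Fin d → ℤ) {z : ℂ} (hz : z ∈ strip d) :
    (if x = 0 then 1 else 0) + h d x z = green x z := by
  have ha : 0 < 1 - 2 * d * |z.re| := by linarith [strip_bound hd hz]
  set a := 1 - 2 * d * |z.re| with ha_def
  set F : ℝ → (Fin d → ℝ) → ℂ := fun y θ =>
    character x θ * exp (-(1 - 2 * z * cosSum θ) * y) with hF
  have hint : Integrable (Function.uncurry F)
      ((volume.restrict (Set.Ioi (0 : ℝ))).prod (torusMeasure d)) := by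
    have hdom : Integrable (fun p : ℝ × (Fin d → ℝ) => Real.exp (-a * p.1))
        ((volume.restrict (Set.Ioi (0 : ℝ))).prod (torusMeasure d)) :=
      Integrable.comp_fst (f := fun y : ℝ => Real.exp (-a * y))
        (exp_neg_integrableOn_Ioi 0 ha) (torusMeasure d)
    refine hdom.mono' ?_ ?_
    · refine Continuous.aestronglyMeasurable ?_
      have := continuous_character x
      have := continuous_cosSum (d := d)
      simp only [hF, Function.uncurry_def]
      fun_prop
    · have hpos : ∀ᵐ p ∂((volume.restrict (Set.Ioi (0 : ℝ))).prod (torusMeasure d)),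
          p.1 ∈ Set.Ioi (0 : ℝ) :=
        Measure.quasiMeasurePreserving_fst.ae (ae_restrict_mem measurableSet_Ioi)
      filter_upwards [hpos] with p hp
      simp only [hF, Function.uncurry_def, norm_mul, norm_character, one_mul, norm_exp]
      refine Real.exp_le_exp.mpr ?_
      rw [re_mul_ofReal]
      refine mul_le_mul_of_nonneg_right ?_ (le_of_lt hp)
      have := re_mul_cosSum_le z p.2
      simp only [neg_re, sub_re, one_re]
      linarith
  have hmain : ∫ y in Set.Ioi (0 : ℝ),
      exp (-(y : ℂ)) * ∏ i : Fin d, besselI (x i) (2 * (y : ℂ) * z) = green x z := by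
    calc ∫ y in Set.Ioi (0 : ℝ), exp (-(y : ℂ)) * ∏ i : Fin d, besselI (x i) (2 * (y : ℂ) * z)
        = ∫ y in Set.Ioi (0 : ℝ), ∫ θ, F y θ ∂torusMeasure d := by
          refine integral_congr_ae (Filter.Eventually.of_forall fun y => ?_)
          simp only [prod_besselI_eq_integral, hF]
          rw [← integral_const_mul]
          refine integral_congr_ae (Filter.Eventually.of_forall fun θ => ?_)
          simp only
          rw [← mul_assoc, ← Complex.exp_add, mul_comm]
          congr 2
          ring
      _ = ∫ θ, (∫ y in Set.Ioi (0 : ℝ), F y θ) ∂torusMeasure d := integral_integral_swap hint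
      _ = green x z := by
          refine integral_congr_ae (Filter.Eventually.of_forall fun θ => ?_)
          simp only [hF]
          rw [integral_const_mul, integral_exp_mul_complex_Ioi]
          · rw [ofReal_zero, mul_zero, Complex.exp_zero, neg_div_neg_eq, one_div]
          · have := re_mul_cosSum_le z θ
            simp only [neg_re, sub_re, one_re]
            linarith
  rw [h, hmain]
  ring

/-- Orthogonality of characters is the Bessel product formula at `w = 0`. -/
theorem integral_character {d : ℕ} (x : Fin d → ℤ) :
    ∫ θ, character x θ ∂torusMeasure d = if x = 0 then 1 else 0 := by
  have hone : ∀ n : ℤ, besselI n 0 = if n = 0 then 1 else 0 := by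
    intro n
    simp only [besselI, zero_mul, Complex.exp_zero, one_mul]
    rw [intervalIntegral.integral_ofReal]
    split_ifs with hn
    · simp [hn, Real.pi_ne_zero]
    · have hn' : (n : ℝ) ≠ 0 := by exact_mod_cast hn
      rw [intervalIntegral.integral_comp_mul_left (fun t => Real.cos t) hn']
      simp
  have := prod_besselI_eq_integral x 0
  simp only [zero_mul, Complex.exp_zero, one_mul] at this
  rw [← this]
  simp only [hone]
  split_ifs with hx
  · simp [hx]
  · obtain ⟨i, hi⟩ := Function.ne_iff.mp hx
    exact Finset.prod_eq_zero (Finset.mem_univ i) (if_neg hi)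

theorem integrable_torusMeasure_of_continuous_of_bound {d : ℕ} {f : (Fin d → ℝ) → ℂ}
    (hf : Continuous f) {C : ℝ} (hC : ∀ θ, ‖f θ‖ ≤ C) : Integrable f (torusMeasure d) :=
  Integrable.of_bound hf.aestronglyMeasurable C (Filter.Eventually.of_forall hC)

theorem one_sub_ne_zero {d : ℕ} (hd : 1 ≤ d) {z : ℂ} (hz : z ∈ strip d) (θ : Fin d → ℝ) :
    1 - 2 * z * cosSum θ ≠ 0 := by
  intro h0
  have h1 := congrArg re h0
  have := re_mul_cosSum_le z θ
  have := strip_bound hd hz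
  rw [sub_re, one_re, zero_re] at h1
  linarith

theorem continuous_inv_one_sub {d : ℕ} (hd : 1 ≤ d) {z : ℂ} (hz : z ∈ strip d) :
    Continuous fun θ : Fin d → ℝ => (1 - 2 * z * cosSum θ)⁻¹ := by
  have := continuous_cosSum (d := d)
  exact Continuous.inv₀ (by fun_prop) (one_sub_ne_zero hd hz)

theorem norm_inv_one_sub_le {d : ℕ} (hd : 1 ≤ d) {z : ℂ} (hz : z ∈ strip d) (θ : Fin d → ℝ) :
    ‖(1 - 2 * z * cosSum θ)⁻¹‖ ≤ (1 - 2 * d * |z.re|)⁻¹ := by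
  rw [norm_inv]
  refine inv_anti₀ (by linarith [strip_bound hd hz]) ?_
  have h1 := re_le_norm (1 - 2 * z * cosSum θ)
  rw [sub_re, one_re] at h1
  linarith [re_mul_cosSum_le z θ]

/-- The quadratic form of the Green matrix, as a Fourier integral. -/
theorem quadraticForm_eq_integral {d n : ℕ} (Y : Fin n → Fin d → ℤ) (v : Fin n → ℂ)
    {f : (Fin d → ℝ) → ℂ} (hf : Continuous f) {C : ℝ} (hC : ∀ θ, ‖f θ‖ ≤ C) :
    star v ⬝ᵥ (Matrix.of fun i j => ∫ θ, character (Y i - Y j) θ * f θ ∂torusMeasure d).mulVec v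
      = ∫ θ, (‖∑ i, conj (v i) * character (Y i) θ‖ ^ 2 : ℝ) * f θ ∂torusMeasure d := by
  have hint : ∀ i j, Integrable (fun θ => conj (v i) * (character (Y i - Y j) θ * f θ * v j))
      (torusMeasure d) := fun i j =>
    ((integrable_torusMeasure_of_continuous_of_bound ((continuous_character _).mul hf) (C := C)
      fun θ => by rw [Pi.mul_apply, norm_mul, norm_character, one_mul]; exact hC θ).mul_const _).const_mul _
  simp only [dotProduct, Matrix.mulVec, Matrix.of_apply, Finset.mul_sum, Pi.star_apply]
  simp only [← integral_mul_const, star_def, ← integral_const_mul]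
  simp_rw [← integral_finsetSum _ fun j _ => hint _ j]
  rw [← integral_finsetSum _ fun i _ => integrable_finsetSum _ fun j _ => hint i j]
  refine integral_congr_ae (Filter.Eventually.of_forall fun θ => ?_)
  simp only
  rw [ofReal_pow, ← mul_conj', map_sum, Finset.sum_mul_sum, Finset.sum_mul]
  refine Finset.sum_congr rfl fun i _ => ?_
  rw [Finset.sum_mul]
  refine Finset.sum_congr rfl fun j _ => ?_
  rw [character_sub, map_mul, conj_conj]
  ring

theorem le_re_quadraticForm_green {d n : ℕ} (hd : 1 ≤ d) {Y : Fin n → Fin d → ℤ}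
    (hY : ∀ i j, i ≠ j → Y i ≠ Y j) {z : ℂ} (hz : z ∈ strip d) {m : ℝ}
    (hm : ∀ θ : Fin d → ℝ, m ≤ ((1 - 2 * z * cosSum θ)⁻¹).re) (v : Fin n → ℂ) :
    m * ∑ i, ‖v i‖ ^ 2
      ≤ (star v ⬝ᵥ (Matrix.of fun i j => green (Y i - Y j) z).mulVec v).re := by
  set q : (Fin d → ℝ) → ℝ := fun θ => ‖∑ i, conj (v i) * character (Y i) θ‖ ^ 2 with hq
  have hqc : Continuous q := by
    have := fun i => continuous_character (Y i)
    simp only [hq]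
    fun_prop
  have hqb : ∀ θ, ‖q θ‖ ≤ (∑ i, ‖v i‖) ^ 2 := by
    intro θ
    rw [Real.norm_of_nonneg (by positivity)]
    refine pow_le_pow_left₀ (norm_nonneg _) ((norm_sum_le _ _).trans_eq ?_) 2
    simp [norm_character]
  have hsum : ∫ θ, q θ ∂torusMeasure d = ∑ i, ‖v i‖ ^ 2 := by
    have h1 := quadraticForm_eq_integral Y v (f := fun _ => 1) continuous_const (C := 1) (by simp)
    simp only [mul_one, integral_character, sub_eq_zero] at h1
    have h2 : (Matrix.of fun i j => if Y i = Y j then (1 : ℂ) else 0) = 1 := by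
      ext i j
      rw [Matrix.of_apply, Matrix.one_apply]
      refine if_congr ⟨fun h => ?_, fun h => h ▸ rfl⟩ rfl rfl
      by_contra hij
      exact hY i j hij h
    rw [h2, Matrix.one_mulVec] at h1
    have h4 := integral_ofReal (𝕜 := ℂ) (f := q) (μ := torusMeasure d)
    have h3 : star v ⬝ᵥ v = ((∑ i, ‖v i‖ ^ 2 : ℝ) : ℂ) := by
      simp [dotProduct, conj_mul']
    rw [h3] at h1
    exact ofReal_injective (h4.symm.trans h1.symm)
  have hqi : Integrable q (torusMeasure d) :=
    Integrable.of_bound hqc.aestronglyMeasurable _ (Filter.Eventually.of_forall hqb)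
  have hprod : Integrable (fun θ => (q θ : ℂ) * (1 - 2 * z * cosSum θ)⁻¹) (torusMeasure d) := by
    refine integrable_torusMeasure_of_continuous_of_bound
      ((continuous_ofReal.comp hqc).mul (continuous_inv_one_sub hd hz))
      (C := (∑ i, ‖v i‖) ^ 2 * (1 - 2 * d * |z.re|)⁻¹) fun θ => ?_
    rw [norm_mul, norm_real]
    exact mul_le_mul (hqb θ) (norm_inv_one_sub_le hd hz θ) (norm_nonneg _) (by positivity)
  have hform := quadraticForm_eq_integral Y v (continuous_inv_one_sub hd hz)
    (norm_inv_one_sub_le hd hz)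
  simp only [green]
  rw [hform, ← hsum, ← integral_const_mul]
  have hre := integral_re hprod
  simp only [RCLike.re_eq_complex_re] at hre
  rw [← hre]
  refine integral_mono (hqi.const_mul m) hprod.re fun θ => ?_
  simp only [re_ofReal_mul]
  rw [mul_comm]
  exact mul_le_mul_of_nonneg_left (hm θ) (by positivity)

theorem le_re_green_zero {d : ℕ} (hd : 1 ≤ d) {z : ℂ} (hz : z ∈ strip d) {m : ℝ}
    (hm : ∀ θ : Fin d → ℝ, m ≤ ((1 - 2 * z * cosSum θ)⁻¹).re) :
    m ≤ (green (0 : Fin d → ℤ) z).re := by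
  have := le_re_quadraticForm_green hd (n := 1) (Y := fun _ => 0)
    (fun i j hij => absurd (Subsingleton.elim i j) hij) hz hm (fun _ => 1)
  simpa [dotProduct, Matrix.mulVec] using this

theorem notMem_poleSet {d : ℕ} (hd : 1 ≤ d) {z : ℂ} (hz : z ∈ strip d) {m : ℝ} (hm0 : 0 < m)
    (hm : ∀ θ : Fin d → ℝ, m ≤ ((1 - 2 * z * cosSum θ)⁻¹).re) : z ∉ poleSet d := by
  rintro ⟨-, h0⟩
  have h1 := delta_add_h_eq_green hd 0 hz
  rw [if_pos rfl, h0] at h1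
  have h2 := le_re_green_zero hd hz hm
  rw [← h1, zero_re] at h2
  linarith

/-- The Fourier lower bound for the first hit determinant. -/
theorem div_pow_le_norm_hitDet {d n : ℕ} (hd : 1 ≤ d) {Y : Fin (n + 1) → Fin d → ℤ}
    (hY : ∀ i j, i ≠ j → Y i ≠ Y j) {z : ℂ} (hz : z ∈ strip d) {m : ℝ} (hm0 : 0 < m)
    (hm : ∀ θ : Fin d → ℝ, m ≤ ((1 - 2 * z * cosSum θ)⁻¹).re) :
    (m / (1 + ‖h d 0 z‖)) ^ n ≤ ‖hitDet Y z‖ := by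
  have hg : 1 + h d 0 z = green (0 : Fin d → ℤ) z := by
    have := delta_add_h_eq_green hd 0 hz
    rwa [if_pos rfl] at this
  have hg0 : 0 < ‖1 + h d 0 z‖ := by
    rw [hg]
    exact hm0.trans_le ((le_re_green_zero hd hz hm).trans (re_le_norm _))
  have hmat : 1 + hitMatrix Y z
      = (1 + h d 0 z)⁻¹ • Matrix.of fun i j => green (Y i - Y j) z := by
    ext i j
    rw [Matrix.smul_apply, Matrix.of_apply, Matrix.add_apply, hitMatrix, Matrix.of_apply,
      Matrix.one_apply, smul_eq_mul]
    split_ifs with hij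
    · rw [hij, sub_self, ← hg, add_zero, inv_mul_cancel₀ (norm_pos_iff.mp hg0)]
    · rw [← delta_add_h_eq_green hd _ hz, if_neg (sub_ne_zero.mpr (hY i j hij))]
      ring
  have hdet := pow_mul_norm_le_norm_det hm0.le n (Matrix.of fun i j => green (Y i - Y j) z)
    (le_re_quadraticForm_green hd hY hz hm)
  rw [Matrix.of_apply, sub_self, ← hg] at hdet
  rw [hitDet, hmat, Matrix.det_smul, Fintype.card_fin, norm_mul, norm_pow, norm_inv]
  have hle : ‖1 + h d 0 z‖ ≤ 1 + ‖h d 0 z‖ := by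
    simpa using norm_add_le 1 (h d 0 z)
  calc (m / (1 + ‖h d 0 z‖)) ^ n ≤ (m / ‖1 + h d 0 z‖) ^ n := by gcongr
    -- The corner entry `G(0)` cancels one of the `n + 1` normalising factors, leaving the exponent
    -- `r - 1`.
    _ = ‖1 + h d 0 z‖⁻¹ ^ (n + 1) * (m ^ n * ‖1 + h d 0 z‖) := by
        rw [div_pow, pow_succ, inv_pow]
        field_simp
    _ ≤ _ := by gcongr

/-! ### Lower bounds for the real part of `1 / (1 - w)` -/

theorem inv_one_sub_re_pos_bound {d : ℕ} (hd : 1 ≤ d) {z : ℂ} (hz : z ∈ strip d)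
    (θ : Fin d → ℝ) :
    (1 - 2 * d * |z.re|) / (1 + 2 * d * ‖z‖) ^ 2 ≤ ((1 - 2 * z * cosSum θ)⁻¹).re := by
  have h1 := re_mul_cosSum_le z θ
  have h2 := strip_bound hd hz
  have hpos : 0 < ‖1 - 2 * z * cosSum θ‖ := norm_pos_iff.mpr (one_sub_ne_zero hd hz θ)
  have hle : ‖1 - 2 * z * cosSum θ‖ ≤ 1 + 2 * d * ‖z‖ := by
    refine (norm_sub_le _ _).trans ?_
    rw [norm_one]
    linarith [norm_mul_cosSum_le z θ]
  rw [inv_re, normSq_eq_norm_sq]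
  refine div_le_div₀ ?_ ?_ (by positivity) (pow_le_pow_left₀ hpos.le hle 2)
  · rw [sub_re, one_re]; linarith
  · rw [sub_re, one_re]; linarith

/-- If `w` has norm slightly larger than one but stays away from the line `Re w = 1`, then the
real part of `1 / (1 - w)` is not much smaller than `1 / 2`. -/
theorem le_re_inv_one_sub {w : ℂ} {a b c : ℝ} (ha : 0 < a) (hre : w.re ≤ 1 - a)
    (hw : ‖w‖ ^ 2 ≤ 1 + b) (hb : b ≤ (1 - c) * a ^ 2) (hc : c ≤ 1) :
    c / 2 ≤ ((1 - w)⁻¹).re := by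
  have hsq : normSq (1 - w) = 1 - 2 * w.re + ‖w‖ ^ 2 := by
    rw [← normSq_eq_norm_sq, normSq_apply, normSq_apply]
    simp
    ring
  have hge : a ^ 2 ≤ normSq (1 - w) := by
    rw [normSq_apply, sub_re, one_re]
    nlinarith [mul_self_nonneg (1 - w).im]
  have hpos : 0 < normSq (1 - w) := lt_of_lt_of_le (by positivity) hge
  rw [inv_re, le_div_iff₀ hpos, sub_re, one_re]
  -- `2(1 - Re w) = |1 - w|² + 1 - |w|² ≥ |1 - w|² - (1 - c)a² ≥ c|1 - w|²`.
  nlinarith [mul_le_mul_of_nonneg_left hge (sub_nonneg.mpr hc)]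

theorem exists_pos_lt_one_le_pow (n : ℕ) {γ : ℝ} (hγ : γ < 1) :
    ∃ c : ℝ, 0 < c ∧ c < 1 ∧ γ ≤ c ^ n := by
  have hcont : Filter.Tendsto (fun c : ℝ => c ^ n) (nhdsWithin 1 (Set.Iio 1)) (nhds 1) := by
    have : Filter.Tendsto (fun c : ℝ => c ^ n) (nhds 1) (nhds (1 ^ n)) :=
      (continuous_pow n).tendsto 1
    rw [one_pow] at this
    exact this.mono_left nhdsWithin_le_nhds
  have h1 : ∀ᶠ c : ℝ in nhdsWithin 1 (Set.Iio 1), γ < c ^ n := hcont.eventually (lt_mem_nhds hγ)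
  have h2 : ∀ᶠ c : ℝ in nhdsWithin 1 (Set.Iio 1), 0 < c :=
    nhdsWithin_le_nhds (lt_mem_nhds one_pos)
  obtain ⟨c, ⟨hc1, hc2⟩, hc3⟩ := ((h1.and h2).and self_mem_nhdsWithin).exists
  exact ⟨c, hc2, hc3, hc1.le⟩

theorem isOpen_strip (d : ℕ) : IsOpen (strip d) :=
  isOpen_lt (by fun_prop) continuous_const

end FirstHit

end

theorem mainTheorem8 (d r : ℕ) (hd : 1 ≤ d) (hr : 1 ≤ r) :
    (∀ δ γ : ℝ, 0 < δ → γ < 1 →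
      ∃ ε : ℝ, 0 < ε ∧
        ∀ z ∈ FirstHit.slab (1 / (2 * (d : ℝ)) + ε) (1 / (2 * (d : ℝ)) - δ),
          z ∈ FirstHit.strip d \ FirstHit.poleSet d ∧
          ∀ Y ∈ FirstHit.J d r,
            γ / (2 * (1 + ‖FirstHit.h d 0 z‖)) ^ (r - 1) ≤ ‖FirstHit.hitDet Y z‖) ∧
    (∃ U : Set ℂ, IsOpen U ∧
      Metric.closedBall (0 : ℂ) (1 / (2 * (d : ℝ))) ∩ FirstHit.strip d ⊆ U ∧
      U ⊆ FirstHit.strip d \ FirstHit.poleSet d ∧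
      ∀ z ∈ U, ∀ Y ∈ FirstHit.J d r, FirstHit.hitDet Y z ≠ 0) := by
  obtain ⟨n, rfl⟩ : ∃ n, r = n + 1 := ⟨r - 1, by omega⟩
  have hd' : (0 : ℝ) < d := by exact_mod_cast hd
  -- The entire strip serves as `U` in (2).
  refine ⟨fun δ γ hδ hγ => ?_, FirstHit.strip d, FirstHit.isOpen_strip d,
    Set.inter_subset_right, fun z hz => ⟨hz, ?_⟩, fun z hz Y hY => ?_⟩
  · obtain ⟨c, hc0, hc1, hcγ⟩ := FirstHit.exists_pos_lt_one_le_pow n hγ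
    -- With `η ≤ 1`, `|w|² ≤ (1 + η)² ≤ 1 + 3η`; the other bound makes `3η ≤ (1 - c)a²` for `a =
    -- 2dδ`, the distance kept from `Re w = 1`.
    set η : ℝ := min 1 ((1 - c) * (2 * d * δ) ^ 2 / 3) with hη
    have hη0 : 0 < η := by
      have : 0 < 1 - c := by linarith
      exact lt_min one_pos (by positivity)
    have hη1 : η ≤ 1 := min_le_left _ _
    have hη2 : 3 * η ≤ (1 - c) * (2 * d * δ) ^ 2 := by
      have : η ≤ (1 - c) * (2 * d * δ) ^ 2 / 3 := min_le_right _ _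
      linarith
    refine ⟨η / (2 * d), by positivity, fun z hz => ?_⟩
    have hstrip : z ∈ FirstHit.strip d := by
      have : |z.re| ≤ 1 / (2 * (d : ℝ)) - δ := hz.2
      have : |z.re| < 1 / (2 * (d : ℝ)) := by linarith
      exact this
    have hnorm : 2 * d * ‖z‖ ≤ 1 + η := by
      have := mul_le_mul_of_nonneg_left hz.1 (by positivity : (0 : ℝ) ≤ 2 * d)
      refine this.trans_eq ?_
      field_simp
    have hreal : 2 * d * |z.re| ≤ 1 - 2 * d * δ := by
      have := mul_le_mul_of_nonneg_left hz.2 (by positivity : (0 : ℝ) ≤ 2 * d)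
      refine this.trans_eq ?_
      field_simp
    have hm : ∀ θ : Fin d → ℝ, c / 2 ≤ ((1 - 2 * z * FirstHit.cosSum θ)⁻¹).re := by
      intro θ
      refine FirstHit.le_re_inv_one_sub (a := 2 * d * δ) (b := 3 * η) (by positivity)
        ((FirstHit.re_mul_cosSum_le z θ).trans hreal) ?_ hη2 hc1.le
      have h1 := pow_le_pow_left₀ (norm_nonneg _)
        ((FirstHit.norm_mul_cosSum_le z θ).trans hnorm) 2
      nlinarith
    refine ⟨⟨hstrip, FirstHit.notMem_poleSet hd hstrip (by positivity) hm⟩, fun Y hY => ?_⟩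
    refine le_trans ?_ (FirstHit.div_pow_le_norm_hitDet hd hY.2 hstrip (by positivity) hm)
    rw [Nat.add_sub_cancel, div_div, div_pow]
    gcongr
  · exact FirstHit.notMem_poleSet hd hz
      (by have := FirstHit.strip_bound hd hz
          exact div_pos (by linarith) (by positivity))
      (FirstHit.inv_one_sub_re_pos_bound hd hz)
  · have hm0 : 0 < (1 - 2 * d * |z.re|) / (1 + 2 * d * ‖z‖) ^ 2 := by
      have := FirstHit.strip_bound hd hz
      exact div_pos (by linarith) (by positivity)
    have := FirstHit.div_pow_le_norm_hitDet hd hY.2 hz hm0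
      (FirstHit.inv_one_sub_re_pos_bound hd hz)
    exact norm_pos_iff.mp (lt_of_lt_of_le (by positivity) this)
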